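/- There is an absolute constant $C>0$ with the following property. Let $n$ be a natural number and let $y$ be a random vector in $\mathbb R^n$ in the isotropic position, that is, $\mathbb E\, y\otimes y=\mathrm{id}$, where $x\otimes x$ denotes the operator $z\mapsto\langle x,z\rangle x$ on $\mathbb R^n$. Let $M$ be a natural number with $\log M\ge 2$ (that is, $M\ge 8$; $\log$ is the natural logarithm), and let $y_1,\dots,y_M$ be independent copies of $y$. Then $$\mathbb E\,\Bigl\|\frac1M\sum_{i=1}^M y_i\otimes y_i-\mathrm{id}\Bigr\|\ \le\ C\cdot\frac{\sqrt{\log M}}{\sqrt M}\cdot\bigl(\mathbb E\,\|y\|^{\log M}\bigr)^{1/\log M},$$ provided that the right-hand side is smaller than $1$. Here $\|\cdot\|$ is the Euclidean norm for vectors and the corresponding operator norm for operators. -/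

import Mathlib

open MeasureTheory ProbabilityTheory

noncomputable section

/-- The rank-one operator `x ⊗ x` on Euclidean space `ℝⁿ`, sending `z` to `⟨x, z⟩ x`. -/
def tens {n : ℕ} (x : EuclideanSpace ℝ (Fin n)) :
    EuclideanSpace ℝ (Fin n) →L[ℝ] EuclideanSpace ℝ (Fin n) :=
  InnerProductSpace.rankOne ℝ x x

theorem tens_apply {n : ℕ} (x z : EuclideanSpace ℝ (Fin n)) :
    tens x z = inner ℝ x z • x := by
  simp [tens]

/-- A random vector `y` in `ℝⁿ` is in the isotropic position if `E y ⊗ y = id`, the expectation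
being that of an integrable operator-valued random variable. -/
def IsIsotropic {n : ℕ} {Ω : Type*} [MeasurableSpace Ω] (μ : Measure Ω)
    (y : Ω → EuclideanSpace ℝ (Fin n)) : Prop :=
  Integrable (fun ω => tens (y ω)) μ ∧
    ∫ ω, tens (y ω) ∂μ = ContinuousLinearMap.id ℝ (EuclideanSpace ℝ (Fin n))

/-- The expectation `E ‖(1/M) ∑ yᵢ ⊗ yᵢ - id‖` of the operator norm, in `[0, ∞]`. -/
def expectedDeviation {n M : ℕ} {Ω : Type*} [MeasurableSpace Ω] (ν : Measure Ω)
    (y : Fin M → Ω → EuclideanSpace ℝ (Fin n)) : ENNReal :=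
  ∫⁻ ω, ‖(1 / (M : ℝ)) • ∑ i, tens (y i ω)
    - ContinuousLinearMap.id ℝ (EuclideanSpace ℝ (Fin n))‖ₑ ∂ν

/-- The number `C √(log M) / √M · (E ‖y‖ ^ log M) ^ (1 / log M)`, in `[0, ∞]`
(it is `∞` when the moment is infinite and `C > 0`, `M > 1`). -/
def deviationBound {n : ℕ} (C : ℝ) (M : ℕ) {Ω : Type*} [MeasurableSpace Ω] (μ : Measure Ω)
    (y : Ω → EuclideanSpace ℝ (Fin n)) : ENNReal :=
  ENNReal.ofReal (C * (√(Real.log M) / √(M : ℝ))) *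
    (∫⁻ ω, ‖y ω‖ₑ ^ Real.log M ∂μ) ^ (1 / Real.log M)

end

/-!
The proof is Rudelson's: symmetrize, bound the resulting Rademacher average for a fixed sample, and
close up a self-bounding inequality for the expected deviation `D`.

Symmetrization (`lintegral_enorm_sum_sub_integral_le`) replaces the centred sum by
`∑ εᵢ yᵢ ⊗ yᵢ` with signs `ε`, at the cost of a factor `2`, for every sign pattern and hence for the
average over all of them. For fixed vectors, `average_norm_signedSum_le` bounds this average by
`3 √(log M) · max ‖yᵢ‖ · ‖∑ yᵢ ⊗ yᵢ‖ ^ (1/2)` when the dimension is at most `M`. By Cauchy-Schwarz,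
and since an `L²` norm is at most an `L^(log M)` norm, integrating gives `D ≤ (b/2) √(D + 1)` with
`b` the claimed bound: the maximum is dominated by an `ℓ^(log M)` norm, which loses only
`M ^ (1 / log M) = e`. As `D` is finite and `b < 1`, this forces `D ≤ b`. The dimension is indeed at
most `M`, because `n = E ‖y‖²` and `b < 1` (`dim_le_of_deviationBound_lt_one`).

The Rademacher bound is obtained by Tropp's elementary trace-moment argument. For `X = ∑ εᵢ xᵢ ⊗ xᵢ`,
write `tr X^(2r+2) = ∑ εᵢ ⟨xᵢ, X^(2r+1) xᵢ⟩` and pair each `ε` with the pattern whose `i`-th sign is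
reversed. The difference of the two powers telescopes into products `⟨xᵢ, A^q xᵢ⟩ ⟨xᵢ, B^(2r-q) xᵢ⟩`,
which the spectral theorem and a rearrangement inequality for pairs of eigenvalues bound by the
extreme terms (`sum_inner_pow_mul_inner_pow_le`). Hence the average of `tr X^(2r+2)` is at most
`(2r+1) max ‖xᵢ‖² ‖∑ xᵢ ⊗ xᵢ‖` times that of `tr X^(2r)`, and iterating up to `r ≈ log M` yields the
operator norm.
-/

/-! ### Powers of symmetric operators -/

section Operators

open InnerProductSpace

variable {E : Type*} [NormedAddCommGroup E] [InnerProductSpace ℝ E]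

theorem exists_orthonormalBasis_eigenvectors [FiniteDimensional ℝ E] {A : E →L[ℝ] E}
    (hA : (A : E →ₗ[ℝ] E).IsSymmetric) :
    ∃ (b : OrthonormalBasis (Fin (Module.finrank ℝ E)) ℝ E) (l : Fin (Module.finrank ℝ E) → ℝ),
      ∀ (k : ℕ) (i : Fin (Module.finrank ℝ E)), (A ^ k) (b i) = l i ^ k • b i := by
  refine ⟨hA.eigenvectorBasis rfl, hA.eigenvalues rfl, fun k i => ?_⟩
  have h : A (hA.eigenvectorBasis rfl i) = hA.eigenvalues rfl i • hA.eigenvectorBasis rfl i := by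
    exact hA.apply_eigenvectorBasis rfl i
  induction k with
  | zero => simp
  | succ k ih => rw [pow_succ', mul_apply_eq_comp, ih, map_smul, h, smul_smul, pow_succ]

theorem inner_apply_eq_sum {ι : Type*} [Fintype ι] (b : OrthonormalBasis ι ℝ E) {A : E →L[ℝ] E}
    {l : ι → ℝ} (h : ∀ i, A (b i) = l i • b i) (x : E) :
    inner ℝ x (A x) = ∑ i, l i * inner ℝ x (b i) ^ 2 := by
  have hx : A x = ∑ i, inner ℝ (b i) x • l i • b i := by
    conv_lhs => rw [← b.sum_repr' x]
    simp [h]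
  rw [hx, inner_sum]
  refine Finset.sum_congr rfl fun i _ => ?_
  rw [inner_smul_right, inner_smul_right, real_inner_comm x (b i)]
  ring

/-- The telescoping identity for a difference of powers of operators whose difference is a
multiple of a rank-one operator. -/
theorem inner_pow_sub_pow {A B : E →L[ℝ] E} {x : E} {c : ℝ}
    (h : A - B = c • rankOne ℝ x x) (m : ℕ) :
    inner ℝ x ((A ^ m - B ^ m) x) = c * ∑ q ∈ Finset.range m,
      inner ℝ x ((A ^ q) x) * inner ℝ x ((B ^ (m - 1 - q)) x) := by
  have key : ∀ m, A ^ m - B ^ m = ∑ q ∈ Finset.range m, A ^ q * (A - B) * B ^ (m - 1 - q) := by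
    intro m
    induction m with
    | zero => simp
    | succ m ih =>
      have h1 : A ^ (m + 1) - B ^ (m + 1) = (A ^ m - B ^ m) * B + A ^ m * (A - B) := by
        rw [pow_succ, pow_succ]; noncomm_ring
      rw [h1, ih, Finset.sum_range_succ, Finset.sum_mul]
      congr 1
      · refine Finset.sum_congr rfl fun q hq => ?_
        have : m + 1 - 1 - q = (m - 1 - q) + 1 := by have := Finset.mem_range.1 hq; omega
        rw [this, pow_succ]; noncomm_ring
      · simp
  rw [key, sum_apply, inner_sum, Finset.mul_sum]
  refine Finset.sum_congr rfl fun q _ => ?_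
  simp only [h, mul_apply_eq_comp, smul_apply, rankOne_apply,
    map_smul, inner_smul_right]
  ring

theorem sum_pow_mul_pow_le (s t : ℝ) (r : ℕ) :
    ∑ q ∈ Finset.range (2 * r + 1), s ^ q * t ^ (2 * r - q) ≤
      (2 * r + 1) / 2 * (s ^ (2 * r) + t ^ (2 * r)) := by
  have hpair : ∀ q ∈ Finset.range (2 * r + 1),
      s ^ q * t ^ (2 * r - q) + s ^ (2 * r - q) * t ^ q ≤ s ^ (2 * r) + t ^ (2 * r) := by
    intro q hq
    obtain ⟨k, hk⟩ : ∃ k, 2 * r = q + k := ⟨2 * r - q, by have := Finset.mem_range.1 hq; omega⟩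
    have hk' : 2 * r - q = k := by omega
    have hs : s ^ (2 * r) = |s| ^ q * |s| ^ k := by rw [← pow_add, ← hk, Even.pow_abs ⟨r, by ring⟩]
    have ht : t ^ (2 * r) = |t| ^ q * |t| ^ k := by rw [← pow_add, ← hk, Even.pow_abs ⟨r, by ring⟩]
    rw [hk', hs, ht]
    have h1 : s ^ q * t ^ k ≤ |s| ^ q * |t| ^ k := by
      rw [← abs_pow, ← abs_pow, ← abs_mul]; exact le_abs_self _
    have h2 : s ^ k * t ^ q ≤ |s| ^ k * |t| ^ q := by
      rw [← abs_pow, ← abs_pow, ← abs_mul]; exact le_abs_self _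
    have h3 : 0 ≤ (|s| ^ q - |t| ^ q) * (|s| ^ k - |t| ^ k) := by
      rcases le_total |s| |t| with h | h
      · exact mul_nonneg_of_nonpos_of_nonpos (sub_nonpos.2 (by gcongr)) (sub_nonpos.2 (by gcongr))
      · exact mul_nonneg (sub_nonneg.2 (by gcongr)) (sub_nonneg.2 (by gcongr))
    nlinarith
  have hrefl : ∑ q ∈ Finset.range (2 * r + 1), s ^ (2 * r - q) * t ^ q =
      ∑ q ∈ Finset.range (2 * r + 1), s ^ q * t ^ (2 * r - q) := by
    rw [← Finset.sum_range_reflect]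
    refine Finset.sum_congr rfl fun q hq => ?_
    have := Finset.mem_range.1 hq
    congr 2; omega
  have h := Finset.sum_le_sum hpair
  rw [Finset.sum_add_distrib, hrefl, Finset.sum_const, Finset.card_range, nsmul_eq_mul] at h
  push_cast at h
  linarith

/-- The spectral theorem for `A` and `B` reduces this to `sum_pow_mul_pow_le` for pairs of
eigenvalues. -/
theorem sum_inner_pow_mul_inner_pow_le [FiniteDimensional ℝ E] {A B : E →L[ℝ] E}
    (hA : (A : E →ₗ[ℝ] E).IsSymmetric) (hB : (B : E →ₗ[ℝ] E).IsSymmetric) (x : E) (r : ℕ) :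
    ∑ q ∈ Finset.range (2 * r + 1), inner ℝ x ((A ^ q) x) * inner ℝ x ((B ^ (2 * r - q)) x) ≤
      (2 * r + 1) / 2 * ‖x‖ ^ 2 *
        (inner ℝ x ((A ^ (2 * r)) x) + inner ℝ x ((B ^ (2 * r)) x)) := by
  obtain ⟨a, s, ha⟩ := exists_orthonormalBasis_eigenvectors hA
  obtain ⟨b, t, hb⟩ := exists_orthonormalBasis_eigenvectors hB
  have hna : ∑ i, inner ℝ x (a i) ^ 2 = ‖x‖ ^ 2 := by
    simpa using a.sum_sq_norm_inner_left x
  have hnb : ∑ i, inner ℝ x (b i) ^ 2 = ‖x‖ ^ 2 := by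
    simpa using b.sum_sq_norm_inner_left x
  simp only [fun k => inner_apply_eq_sum a (ha k) x, fun k => inner_apply_eq_sum b (hb k) x]
  calc ∑ q ∈ Finset.range (2 * r + 1), (∑ i, s i ^ q * inner ℝ x (a i) ^ 2) *
          ∑ j, t j ^ (2 * r - q) * inner ℝ x (b j) ^ 2
      = ∑ i, ∑ j, inner ℝ x (a i) ^ 2 * inner ℝ x (b j) ^ 2 *
          ∑ q ∈ Finset.range (2 * r + 1), s i ^ q * t j ^ (2 * r - q) := by
        simp_rw [Finset.sum_mul_sum, Finset.mul_sum]
        rw [Finset.sum_comm]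
        refine Finset.sum_congr rfl fun i _ => ?_
        rw [Finset.sum_comm]
        refine Finset.sum_congr rfl fun j _ => Finset.sum_congr rfl fun q _ => ?_
        ring
    _ ≤ ∑ i, ∑ j, inner ℝ x (a i) ^ 2 * inner ℝ x (b j) ^ 2 *
          ((2 * r + 1) / 2 * (s i ^ (2 * r) + t j ^ (2 * r))) := by
        gcongr
        exact sum_pow_mul_pow_le _ _ _
    _ = (2 * r + 1) / 2 * ((∑ j, inner ℝ x (b j) ^ 2) * ∑ i, s i ^ (2 * r) * inner ℝ x (a i) ^ 2 +
          (∑ i, inner ℝ x (a i) ^ 2) * ∑ j, t j ^ (2 * r) * inner ℝ x (b j) ^ 2) := by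
        rw [mul_comm (∑ j, inner ℝ x (b j) ^ 2), Finset.sum_mul_sum, Finset.sum_mul_sum,
          ← Finset.sum_add_distrib, Finset.mul_sum]
        refine Finset.sum_congr rfl fun i _ => ?_
        rw [← Finset.sum_add_distrib, Finset.mul_sum]
        exact Finset.sum_congr rfl fun j _ => by ring
    _ = _ := by rw [hna, hnb]; ring

theorem norm_pow_le_trace [FiniteDimensional ℝ E] {A : E →L[ℝ] E}
    (hA : (A : E →ₗ[ℝ] E).IsSymmetric) {p : ℕ} (hp : p ≠ 0) :
    ‖A‖ ^ (2 * p) ≤ LinearMap.trace ℝ E (A ^ (2 * p) : E →L[ℝ] E) := by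
  obtain ⟨b, l, hb⟩ := exists_orthonormalBasis_eigenvectors hA
  set T := LinearMap.trace ℝ E (A ^ (2 * p) : E →L[ℝ] E) with hT
  have hTs : T = ∑ i, l i ^ (2 * p) := by
    rw [hT, LinearMap.trace_eq_sum_inner _ b]
    refine Finset.sum_congr rfl fun i _ => ?_
    rw [ContinuousLinearMap.coe_coe, hb, inner_smul_right]
    simp
  have hpos : ∀ i, 0 ≤ l i ^ (2 * p) := fun i => Even.pow_nonneg ⟨p, by ring⟩ _
  have hT0 : 0 ≤ T := hTs ▸ Finset.sum_nonneg fun i _ => hpos i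
  have h2p : 2 * p ≠ 0 := by omega
  set K := T ^ ((1 : ℝ) / (2 * p : ℕ)) with hK
  have hK0 : 0 ≤ K := by positivity
  have hKp : K ^ (2 * p) = T := by
    rw [hK, ← Real.rpow_natCast, ← Real.rpow_mul hT0, one_div_mul_cancel (by exact_mod_cast h2p),
      Real.rpow_one]
  have hl : ∀ i, |l i| ≤ K := by
    intro i
    refine le_of_pow_le_pow_left₀ h2p hK0 ?_
    rw [hKp, hTs, Even.pow_abs ⟨p, by ring⟩]
    exact Finset.single_le_sum (f := fun i => l i ^ (2 * p)) (fun i _ => hpos i)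
      (Finset.mem_univ i)
  rw [← hKp]
  gcongr
  refine A.opNorm_le_bound hK0 fun v => ?_
  refine le_of_sq_le_sq ?_ (by positivity)
  rw [← b.sum_sq_norm_inner_right (A v), mul_pow, ← b.sum_sq_norm_inner_right v, Finset.mul_sum]
  refine Finset.sum_le_sum fun i _ => ?_
  have h1 : A (b i) = l i • b i := by simpa using hb 1 i
  have h2 : inner ℝ (b i) (A v) = l i * inner ℝ (b i) v := by
    have := hA (b i) v
    simp only [ContinuousLinearMap.coe_coe] at this
    rw [← this, h1, inner_smul_left]; simp
  rw [h2, norm_mul, mul_pow]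
  gcongr
  exact hl i

/-- This is `tr (V A²ʳ) ≤ ‖V‖ tr A²ʳ` for `V = ∑ xᵢ ⊗ xᵢ`, checked on an eigenbasis of `A`. -/
theorem sum_inner_pow_le_norm_mul_trace {ι : Type*} [Fintype ι] [FiniteDimensional ℝ E]
    (x : ι → E) {A : E →L[ℝ] E} (hA : (A : E →ₗ[ℝ] E).IsSymmetric) (r : ℕ) :
    ∑ i, inner ℝ (x i) ((A ^ (2 * r)) (x i)) ≤ ‖∑ i, rankOne ℝ (x i) (x i)‖ *
      LinearMap.trace ℝ E (A ^ (2 * r) : E →L[ℝ] E) := by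
  obtain ⟨b, l, hb⟩ := exists_orthonormalBasis_eigenvectors hA
  have hpos : ∀ i, 0 ≤ l i ^ (2 * r) := fun i => Even.pow_nonneg ⟨r, by ring⟩ _
  rw [LinearMap.trace_eq_sum_inner _ b, Finset.mul_sum]
  simp_rw [inner_apply_eq_sum b (hb (2 * r))]
  rw [Finset.sum_comm]
  refine Finset.sum_le_sum fun k _ => ?_
  rw [ContinuousLinearMap.coe_coe, hb, inner_smul_right, ← Finset.mul_sum,
    real_inner_self_eq_norm_sq, b.norm_eq_one, one_pow, mul_one, mul_comm]
  refine mul_le_mul_of_nonneg_right ?_ (hpos k)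
  have h : ∑ i, inner ℝ (x i) (b k) ^ 2 = inner ℝ (b k) ((∑ i, rankOne ℝ (x i) (x i)) (b k)) := by
    rw [sum_apply, inner_sum]
    refine Finset.sum_congr rfl fun i _ => ?_
    rw [rankOne_apply, inner_smul_right, real_inner_comm (x i) (b k)]; ring
  rw [h]
  calc _ ≤ ‖b k‖ * ‖(∑ i, rankOne ℝ (x i) (x i)) (b k)‖ := real_inner_le_norm _ _
    _ ≤ ‖b k‖ * (‖∑ i, rankOne ℝ (x i) (x i)‖ * ‖b k‖) := by
        gcongr; exact ContinuousLinearMap.le_opNorm _ _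
    _ = _ := by simp

end Operators

/-! ### Rademacher sums of rank-one operators -/

section Rademacher

open InnerProductSpace

variable {E : Type*} [NormedAddCommGroup E] [InnerProductSpace ℝ E] {ι : Type*}

/-- The real sign `±1` encoded by a Boolean: `true` is `1` and `false` is `-1`. -/
def boolSign (b : Bool) : ℝ := if b then 1 else -1

@[simp] theorem boolSign_not (b : Bool) : boolSign (!b) = -boolSign b := by
  cases b <;> simp [boolSign]

theorem boolSign_mul_self (b : Bool) : boolSign b * boolSign b = 1 := by
  cases b <;> simp [boolSign]

/-- The signed sum `∑ εᵢ xᵢ ⊗ xᵢ`. A Rademacher average is the average of a function of `ε` over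
the finite type `ι → Bool` of all sign patterns. -/
noncomputable def signedSum [Fintype ι] (x : ι → E) (ε : ι → Bool) : E →L[ℝ] E :=
  ∑ i, boolSign (ε i) • rankOne ℝ (x i) (x i)

theorem signedSum_isSymmetric [Fintype ι] (x : ι → E) (ε : ι → Bool) :
    (signedSum x ε : E →ₗ[ℝ] E).IsSymmetric := by
  intro u v
  simp only [signedSum, ContinuousLinearMap.coe_coe, sum_apply, sum_inner,
    inner_sum, smul_apply, rankOne_apply, inner_smul_left, inner_smul_right,
    RCLike.conj_to_real]
  refine Finset.sum_congr rfl fun i _ => ?_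
  rw [real_inner_comm (x i) u]; ring

/-- Reversing the sign with index `i`, an involution of the sign patterns. -/
def flipSign [DecidableEq ι] (i : ι) : (ι → Bool) ≃ (ι → Bool) :=
  Function.Involutive.toPerm (fun ε => Function.update ε i (!ε i)) fun ε => by simp

theorem flipSign_apply [DecidableEq ι] (i : ι) (ε : ι → Bool) :
    flipSign i ε = Function.update ε i (!ε i) := rfl

theorem signedSum_sub_signedSum_flipSign [Fintype ι] [DecidableEq ι] (x : ι → E) (i : ι)
    (ε : ι → Bool) :
    signedSum x ε - signedSum x (flipSign i ε) =
      (2 * boolSign (ε i)) • rankOne ℝ (x i) (x i) := by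
  rw [signedSum, signedSum, ← Finset.sum_sub_distrib, Finset.sum_eq_single i]
  · rw [← sub_smul, flipSign_apply, Function.update_self, boolSign_not]; congr 1; ring
  · intro j _ hj
    rw [flipSign_apply, Function.update_of_ne hj, sub_self]
  · simp

/-- The discrete integration by parts: pairing `ε` with the pattern reversed at `i` removes the
sign `εᵢ` and lowers the degree by one. -/
theorem sum_boolSign_mul_inner_pow_le [Fintype ι] [DecidableEq ι] [FiniteDimensional ℝ E]
    (x : ι → E) (i : ι) (r : ℕ) :
    ∑ ε, boolSign (ε i) * inner ℝ (x i) ((signedSum x ε ^ (2 * r + 1)) (x i)) ≤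
      (2 * r + 1) * ‖x i‖ ^ 2 * ∑ ε, inner ℝ (x i) ((signedSum x ε ^ (2 * r)) (x i)) := by
  set F : (ι → Bool) → ℝ := fun ε =>
    boolSign (ε i) * inner ℝ (x i) ((signedSum x ε ^ (2 * r + 1)) (x i)) with hF
  set G : (ι → Bool) → ℝ := fun ε => inner ℝ (x i) ((signedSum x ε ^ (2 * r)) (x i)) with hG
  have hpair : ∀ ε, F ε + F (flipSign i ε) ≤
      (2 * r + 1) * ‖x i‖ ^ 2 * (G ε + G (flipSign i ε)) := by
    intro ε
    have h1 : F ε + F (flipSign i ε) = boolSign (ε i) * inner ℝ (x i)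
        ((signedSum x ε ^ (2 * r + 1) - signedSum x (flipSign i ε) ^ (2 * r + 1)) (x i)) := by
      have hs : boolSign (flipSign i ε i) = -boolSign (ε i) := by simp [flipSign_apply]
      simp only [hF, hs, sub_apply, inner_sub_right]
      ring
    have h2 := sum_inner_pow_mul_inner_pow_le (signedSum_isSymmetric x ε)
      (signedSum_isSymmetric x (flipSign i ε)) (x i) r
    rw [h1, inner_pow_sub_pow (signedSum_sub_signedSum_flipSign x i ε), Nat.add_sub_cancel,
      ← mul_assoc, mul_left_comm, boolSign_mul_self]
    simp only [hG]
    linarith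
  have h := Finset.sum_le_sum fun ε (_ : ε ∈ Finset.univ) => hpair ε
  rw [Finset.sum_add_distrib, ← Finset.mul_sum, Finset.sum_add_distrib,
    Equiv.sum_comp (flipSign i) F, Equiv.sum_comp (flipSign i) G] at h
  linarith

theorem trace_signedSum_pow_succ [Fintype ι] [FiniteDimensional ℝ E] (x : ι → E) (ε : ι → Bool)
    (m : ℕ) :
    LinearMap.trace ℝ E (signedSum x ε ^ (m + 1) : E →L[ℝ] E) =
      ∑ i, boolSign (ε i) * inner ℝ (x i) ((signedSum x ε ^ m) (x i)) := by
  have h : signedSum x ε ^ (m + 1) =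
      ∑ i, boolSign (ε i) • rankOne ℝ ((signedSum x ε ^ m) (x i)) (x i) := by
    rw [pow_succ]
    nth_rewrite 2 [signedSum]
    ext v
    simp
  rw [h, ContinuousLinearMap.toLinearMap_sum, map_sum]
  refine Finset.sum_congr rfl fun i _ => ?_
  rw [ContinuousLinearMap.toLinearMap_smul, map_smul, trace_rankOne, smul_eq_mul]

/-- The recursion on the even trace moments of the signed sum. The factor `R²` comes from
`(xᵢ ⊗ xᵢ)² = ‖xᵢ‖² xᵢ ⊗ xᵢ`. -/
theorem sum_trace_signedSum_pow_succ_le [Fintype ι] [DecidableEq ι] [FiniteDimensional ℝ E]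
    (x : ι → E) {R : ℝ}
    (hR : ∀ i, ‖x i‖ ≤ R) (r : ℕ) :
    ∑ ε, LinearMap.trace ℝ E (signedSum x ε ^ (2 * (r + 1)) : E →L[ℝ] E) ≤
      (2 * r + 1) * (R ^ 2 * ‖∑ i, rankOne ℝ (x i) (x i)‖) *
        ∑ ε, LinearMap.trace ℝ E (signedSum x ε ^ (2 * r) : E →L[ℝ] E) := by
  have hpos : ∀ i ε, 0 ≤ inner ℝ (x i) ((signedSum x ε ^ (2 * r)) (x i)) := by
    intro i ε
    obtain ⟨b, l, hb⟩ := exists_orthonormalBasis_eigenvectors (signedSum_isSymmetric x ε)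
    rw [inner_apply_eq_sum b (hb _)]
    exact Finset.sum_nonneg fun j _ => mul_nonneg (Even.pow_nonneg ⟨r, by ring⟩ _) (sq_nonneg _)
  calc _ = ∑ i, ∑ ε, boolSign (ε i) *
          inner ℝ (x i) ((signedSum x ε ^ (2 * r + 1)) (x i)) := by
        rw [Finset.sum_comm]
        exact Finset.sum_congr rfl fun ε _ => trace_signedSum_pow_succ x ε _
    _ ≤ ∑ i, (2 * r + 1) * R ^ 2 * ∑ ε, inner ℝ (x i) ((signedSum x ε ^ (2 * r)) (x i)) := by
        refine Finset.sum_le_sum fun i _ => (sum_boolSign_mul_inner_pow_le x i r).trans ?_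
        have := Finset.sum_nonneg fun ε (_ : ε ∈ Finset.univ) => hpos i ε
        gcongr
        exact hR i
    _ = (2 * r + 1) * R ^ 2 * ∑ ε, ∑ i, inner ℝ (x i) ((signedSum x ε ^ (2 * r)) (x i)) := by
        rw [← Finset.mul_sum, Finset.sum_comm]
    _ ≤ (2 * r + 1) * R ^ 2 * ∑ ε, ‖∑ i, rankOne ℝ (x i) (x i)‖ *
          LinearMap.trace ℝ E (signedSum x ε ^ (2 * r) : E →L[ℝ] E) := by
        gcongr with ε _
        exact sum_inner_pow_le_norm_mul_trace x (signedSum_isSymmetric x ε) r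
    _ = _ := by rw [← Finset.mul_sum]; ring

theorem sum_trace_signedSum_pow_le [Fintype ι] [DecidableEq ι] [FiniteDimensional ℝ E]
    (x : ι → E) {R : ℝ}
    (hR : ∀ i, ‖x i‖ ≤ R) {p r : ℕ} (hr : r ≤ p) :
    ∑ ε, LinearMap.trace ℝ E (signedSum x ε ^ (2 * r) : E →L[ℝ] E) ≤
      (2 * p * (R ^ 2 * ‖∑ i, rankOne ℝ (x i) (x i)‖)) ^ r *
        (Fintype.card (ι → Bool) * Module.finrank ℝ E) := by
  induction r with
  | zero =>
    simp only [mul_zero, pow_zero, one_mul, Finset.sum_const, Finset.card_univ, nsmul_eq_mul]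
    exact le_of_eq (congrArg _ (LinearMap.trace_one ℝ E))
  | succ r ih =>
    have ih := ih (by omega)
    have hrp : (2 * r + 1 : ℝ) ≤ 2 * p := by exact_mod_cast (by omega : 2 * r + 1 ≤ 2 * p)
    calc _ ≤ _ := sum_trace_signedSum_pow_succ_le x hR r
      _ ≤ (2 * r + 1) * (R ^ 2 * ‖∑ i, rankOne ℝ (x i) (x i)‖) * _ :=
        mul_le_mul_of_nonneg_left ih (by positivity)
      _ ≤ (2 * p) * (R ^ 2 * ‖∑ i, rankOne ℝ (x i) (x i)‖) * _ := by gcongr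
      _ = _ := by rw [pow_succ]; ring

/-- Rudelson's inequality for Rademacher sums, a non-commutative Khinchine inequality: the `2p`-th
Schatten moment is taken with `p = ⌈log M⌉`, for which the dimension contributes only the constant
factor `M ^ (1 / 2p) ≤ √e`. -/
theorem average_norm_signedSum_le [Fintype ι] [DecidableEq ι] [FiniteDimensional ℝ E]
    (x : ι → E) {R : ℝ} (hR0 : 0 ≤ R) (hR : ∀ i, ‖x i‖ ≤ R) {M : ℕ} (hM : 2 ≤ Real.log M)
    (hdim : Module.finrank ℝ E ≤ M) :
    (∑ ε, ‖signedSum x ε‖) / Fintype.card (ι → Bool) ≤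
      3 * √(Real.log M) * R * √‖∑ i, rankOne ℝ (x i) (x i)‖ := by
  set N : ℝ := (Fintype.card (ι → Bool) : ℝ) with hN
  have hN0 : 0 < N := by rw [hN]; exact_mod_cast Fintype.card_pos
  set p := ⌈Real.log M⌉₊ with hp
  have hp1 : Real.log M ≤ p := Nat.le_ceil _
  have hp2 : (p : ℝ) < Real.log M + 1 := Nat.ceil_lt_add_one (by linarith)
  have hp0 : p ≠ 0 := by rintro h; rw [h] at hp1; norm_num at hp1; linarith
  have h2p : 2 * p ≠ 0 := by omega
  set S := ‖∑ i, rankOne ℝ (x i) (x i)‖ with hS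
  have hMpos : (0 : ℝ) < M := by
    rcases Nat.eq_zero_or_pos M with h | h
    · rw [h] at hM; norm_num at hM
    · exact_mod_cast h
  have hMe : (M : ℝ) ≤ Real.exp 1 ^ p := by
    rw [← Real.exp_nat_mul, mul_one, ← Real.log_le_iff_le_exp hMpos]; exact hp1
  refine le_of_pow_le_pow_left₀ h2p (by positivity) ?_
  have hjensen := Real.pow_arith_mean_le_arith_mean_pow (Finset.univ : Finset (ι → Bool))
    (fun _ => 1 / N) (fun ε => ‖signedSum x ε‖) (fun _ _ => by positivity)
    (by simp [hN]) (fun _ _ => norm_nonneg _) (2 * p)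
  calc ((∑ ε, ‖signedSum x ε‖) / N) ^ (2 * p)
      = (∑ ε, 1 / N * ‖signedSum x ε‖) ^ (2 * p) := by rw [← Finset.mul_sum]; ring
    _ ≤ ∑ ε, 1 / N * ‖signedSum x ε‖ ^ (2 * p) := hjensen
    _ = (∑ ε, ‖signedSum x ε‖ ^ (2 * p)) / N := by rw [← Finset.mul_sum]; ring
    _ ≤ ((2 * p * (R ^ 2 * S)) ^ p * (N * Module.finrank ℝ E)) / N := by
        gcongr
        exact (Finset.sum_le_sum fun ε _ => norm_pow_le_trace (signedSum_isSymmetric x ε) hp0).trans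
          (sum_trace_signedSum_pow_le x hR le_rfl)
    _ = (2 * p * (R ^ 2 * S)) ^ p * Module.finrank ℝ E := by field_simp
    _ ≤ (2 * p * (R ^ 2 * S)) ^ p * Real.exp 1 ^ p := by
        gcongr
        exact (by exact_mod_cast hdim : (Module.finrank ℝ E : ℝ) ≤ M).trans hMe
    _ = (2 * p * Real.exp 1 * (R ^ 2 * S)) ^ p := by rw [← mul_pow]; ring
    _ ≤ (9 * Real.log M * (R ^ 2 * S)) ^ p := by
        have he : Real.exp 1 ≤ 3 := by linarith [Real.exp_one_lt_d9]
        have : 2 * p * Real.exp 1 ≤ 9 * Real.log M := by nlinarith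
        gcongr
    _ = (3 * √(Real.log M) * R * √S) ^ (2 * p) := by
        rw [pow_mul]
        congr 1
        rw [mul_pow, mul_pow, mul_pow, Real.sq_sqrt (by linarith), Real.sq_sqrt (norm_nonneg _)]
        ring

end Rademacher

/-! ### Symmetrization -/

section Symmetrization

variable {α F ι : Type*} [MeasurableSpace α] [NormedAddCommGroup F] [Fintype ι]

theorem measurable_enorm_sum_boolSign_smul [NormedSpace ℝ F] {H : α → F} (hH : StronglyMeasurable H)
    (ε : ι → Bool) : Measurable fun z : ι → α => ‖∑ i, boolSign (ε i) • H (z i)‖ₑ :=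
  (Finset.stronglyMeasurable_fun_sum _ fun i _ =>
    (hH.comp_measurable (measurable_pi_apply i)).const_smul (boolSign (ε i))).enorm

theorem integrable_comp_coordinate (P : Measure α) [IsProbabilityMeasure P] {H : α → F}
    (hint : Integrable H P) (i : ι) :
    Integrable (fun z : ι → α => H (z i)) (Measure.pi fun _ => P) :=
  (measurePreserving_eval (fun _ => P) i).integrable_comp_of_integrable hint

/-- Subtracting an independent copy bounds the deviation from the mean by that of a symmetric
variable; exchanging the two copies at the indices where `ε` is negative preserves their law. -/
theorem lintegral_enorm_sum_sub_integral_le [NormedSpace ℝ F] [CompleteSpace F] (P : Measure α)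
    [IsProbabilityMeasure P] {H : α → F} (hH : StronglyMeasurable H) (hint : Integrable H P)
    (ε : ι → Bool) :
    ∫⁻ z : ι → α, ‖∑ i, (H (z i) - ∫ a, H a ∂P)‖ₑ ∂(Measure.pi fun _ => P) ≤
      2 * ∫⁻ z : ι → α, ‖∑ i, boolSign (ε i) • H (z i)‖ₑ ∂(Measure.pi fun _ => P) := by
  set Q : Measure (ι → α) := Measure.pi fun _ => P with hQ
  set D : (ι → α) × (ι → α) → ENNReal := fun w => ‖∑ i, (H (w.1 i) - H (w.2 i))‖ₑ with hD
  have hDm : Measurable D := by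
    refine (Finset.stronglyMeasurable_fun_sum _ fun i _ => ?_).enorm
    exact (hH.comp_measurable ((measurable_pi_apply i).comp measurable_fst)).sub
      (hH.comp_measurable ((measurable_pi_apply i).comp measurable_snd))
  have hmean : ∀ z : ι → α, ∑ i, (H (z i) - ∫ a, H a ∂P) =
      ∫ z', ∑ i, (H (z i) - H (z' i)) ∂Q := by
    intro z
    have hi : ∀ i, Integrable (fun z' : ι → α => H (z' i)) Q :=
      integrable_comp_coordinate P hint
    have hsub : ∀ i, Integrable (fun z' : ι → α => H (z i) - H (z' i)) Q := fun i =>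
      (integrable_const _).sub (hi i)
    rw [integral_finsetSum _ fun i _ => hsub i]
    refine Finset.sum_congr rfl fun i _ => ?_
    rw [integral_sub (integrable_const _) (hi i), integral_const, probReal_univ, one_smul]
    congr 1
    have h := (measurePreserving_eval (fun _ : ι => P) i)
    rw [← h.map_eq, integral_map h.measurable.aemeasurable hH.aestronglyMeasurable]
  have harrow := measurePreserving_arrowProdEquivProdArrow α α ι (fun _ => P) (fun _ => P)
  have hswap : MeasurePreserving
      (fun (w : ι → α × α) i => (if ε i then id else Prod.swap) (w i))
      (Measure.pi fun _ => P.prod P) (Measure.pi fun _ => P.prod P) := by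
    refine measurePreserving_pi _ _ fun i => ?_
    split_ifs
    · exact MeasurePreserving.id _
    · exact Measure.measurePreserving_swap
  have hS := measurable_enorm_sum_boolSign_smul hH ε
  calc ∫⁻ z, ‖∑ i, (H (z i) - ∫ a, H a ∂P)‖ₑ ∂Q
      ≤ ∫⁻ z, ∫⁻ z', D (z, z') ∂Q ∂Q := by
        refine lintegral_mono fun z => ?_
        rw [hmean]
        exact enorm_integral_le_lintegral_enorm _
    _ = ∫⁻ w, D w ∂(Q.prod Q) := (lintegral_prod _ hDm.aemeasurable).symm
    _ = ∫⁻ w : ι → α × α, ‖∑ i, (H (w i).1 - H (w i).2)‖ₑ ∂(Measure.pi fun _ => P.prod P) :=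
        (harrow.lintegral_comp hDm).symm
    _ = ∫⁻ w : ι → α × α, D (fun i => ((if ε i then id else Prod.swap) (w i)).1,
          fun i => ((if ε i then id else Prod.swap) (w i)).2)
          ∂(Measure.pi fun _ => P.prod P) :=
        (hswap.lintegral_comp (hDm.comp harrow.measurable)).symm
    _ ≤ ∫⁻ w : ι → α × α, (‖∑ i, boolSign (ε i) • H (w i).1‖ₑ +
          ‖∑ i, boolSign (ε i) • H (w i).2‖ₑ) ∂(Measure.pi fun _ => P.prod P) := by
        refine lintegral_mono fun w => ?_
        have h : ∑ i, (H ((if ε i then id else Prod.swap) (w i)).1 -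
            H ((if ε i then id else Prod.swap) (w i)).2) =
            ∑ i, boolSign (ε i) • H (w i).1 - ∑ i, boolSign (ε i) • H (w i).2 := by
          rw [← Finset.sum_sub_distrib]
          refine Finset.sum_congr rfl fun i _ => ?_
          cases ε i <;> simp [boolSign]
          abel
        simp only [hD, h]
        exact enorm_sub_le
    _ = ∫⁻ w, (‖∑ i, boolSign (ε i) • H (w.1 i)‖ₑ + ‖∑ i, boolSign (ε i) • H (w.2 i)‖ₑ)
          ∂(Q.prod Q) :=
        harrow.lintegral_comp
          (f := fun w => ‖∑ i, boolSign (ε i) • H (w.1 i)‖ₑ + ‖∑ i, boolSign (ε i) • H (w.2 i)‖ₑ)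
          ((hS.comp measurable_fst).add (hS.comp measurable_snd))
    _ = 2 * ∫⁻ z, ‖∑ i, boolSign (ε i) • H (z i)‖ₑ ∂Q := by
        rw [lintegral_add_left (f := fun w : (ι → α) × (ι → α) => ‖∑ i, boolSign (ε i) • H (w.1 i)‖ₑ)
          (hS.comp measurable_fst), two_mul]
        congr 1
        · exact measurePreserving_fst.lintegral_comp hS
        · exact measurePreserving_snd.lintegral_comp hS

end Symmetrization

/-! ### The deviation of the empirical covariance -/

section Deviation

variable {n M : ℕ}

theorem continuous_tens : Continuous (tens : EuclideanSpace ℝ (Fin n) → _) :=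
  (InnerProductSpace.rankOne ℝ).continuous.clm_apply continuous_id

theorem lintegral_enorm_sq_of_isotropic {P : Measure (EuclideanSpace ℝ (Fin n))}
    (hint : Integrable tens P)
    (hid : ∫ x, tens x ∂P = ContinuousLinearMap.id ℝ (EuclideanSpace ℝ (Fin n))) :
    ∫⁻ x, ‖x‖ₑ ^ (2 : ℝ) ∂P = n := by
  set E := EuclideanSpace ℝ (Fin n)
  set T : (E →L[ℝ] E) →L[ℝ] ℝ :=
    LinearMap.toContinuousLinearMap (LinearMap.trace ℝ E ∘ₗ ContinuousLinearMap.coeLM ℝ) with hT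
  have hTapply : ∀ A : E →L[ℝ] E, T A = LinearMap.trace ℝ E A := fun A => rfl
  have hTt : ∀ x : E, T (tens x) = ‖x‖ ^ 2 := by
    intro x
    rw [hTapply, tens, InnerProductSpace.trace_rankOne, real_inner_self_eq_norm_sq]
  have h1 : ∫ x, ‖x‖ ^ 2 ∂P = n := by
    simp_rw [← hTt]
    rw [T.integral_comp_comm hint, hid, hTapply]
    exact (LinearMap.trace_one ℝ E).trans (by simp [E])
  have h2 : Integrable (fun x : E => ‖x‖ ^ 2) P := by
    simp_rw [← hTt]
    exact T.integrable_comp hint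
  have h3 := ofReal_integral_eq_lintegral_ofReal h2 (Filter.Eventually.of_forall fun x => by
    positivity)
  rw [h1, ENNReal.ofReal_natCast] at h3
  rw [h3]
  refine lintegral_congr fun x => ?_
  rw [ENNReal.ofReal_pow (norm_nonneg _), ofReal_norm, ← ENNReal.rpow_natCast]
  norm_num

/-- In the isotropic position `n = E ‖y‖²`, so a deviation bound below `1` forces `n ≤ M`. -/
theorem dim_le_of_deviationBound_lt_one {P : Measure (EuclideanSpace ℝ (Fin n))}
    [IsProbabilityMeasure P] (hM : 2 ≤ Real.log M) (hint : Integrable tens P)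
    (hid : ∫ x, tens x ∂P = ContinuousLinearMap.id ℝ (EuclideanSpace ℝ (Fin n)))
    {C : ℝ} (hC : 1 ≤ C) (hb : deviationBound C M P id < 1) : n ≤ M := by
  have hMpos : (0 : ℝ) < M := by
    rcases Nat.eq_zero_or_pos M with h | h
    · rw [h] at hM; norm_num at hM
    · exact_mod_cast h
  have hmoment : (n : ENNReal) ^ (1 / 2 : ℝ) ≤
      (∫⁻ x, ‖x‖ₑ ^ Real.log M ∂P) ^ (1 / Real.log M) := by
    rw [← lintegral_enorm_sq_of_isotropic hint hid]
    exact eLpNorm'_le_eLpNorm'_of_exponent_le (f := fun x : EuclideanSpace ℝ (Fin n) => x)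
      (by norm_num) hM P aestronglyMeasurable_id
  have hn : (n : ENNReal) ^ (1 / 2 : ℝ) = ENNReal.ofReal √n := by
    rw [← ENNReal.ofReal_natCast, ENNReal.ofReal_rpow_of_nonneg (by positivity) (by norm_num),
      Real.sqrt_eq_rpow]
  have hlog : 1 ≤ √(Real.log M) := Real.one_le_sqrt.2 (by linarith)
  have hle : ENNReal.ofReal (1 / √M * √n) ≤ deviationBound C M P id := by
    rw [ENNReal.ofReal_mul (by positivity), ← hn]
    refine mul_le_mul' (ENNReal.ofReal_le_ofReal ?_) hmoment
    rw [← mul_div_assoc]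
    gcongr
    nlinarith
  have h := hle.trans_lt hb
  rw [ENNReal.ofReal_lt_one, one_div_mul_eq_div, div_lt_one (by positivity)] at h
  exact_mod_cast ((Real.sqrt_lt_sqrt_iff (by positivity)).1 h).le

/-- The Rademacher inequality with `max ‖zᵢ‖` replaced by the larger `ℓ^(log M)` norm of the
`‖zᵢ‖`, whose moments are computable. -/
theorem sum_enorm_signedSum_le (hM : 2 ≤ Real.log M) (hn : n ≤ M)
    (z : Fin M → EuclideanSpace ℝ (Fin n)) :
    ∑ ε : Fin M → Bool, ‖∑ i, boolSign (ε i) • tens (z i)‖ₑ ≤ (Fintype.card (Fin M → Bool) : ENNReal) *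
      (ENNReal.ofReal (3 * √(Real.log M)) *
        ((∑ i, ‖z i‖ₑ ^ Real.log M) ^ (1 / Real.log M) * ‖∑ i, tens (z i)‖ₑ ^ (1 / 2 : ℝ))) := by
  have hL : 0 < Real.log M := by linarith
  set R : ℝ := (∑ i, ‖z i‖ ^ Real.log M) ^ (1 / Real.log M) with hRdef
  have hs0 : 0 ≤ ∑ i, ‖z i‖ ^ Real.log M := by positivity
  have hR0 : 0 ≤ R := by positivity
  have hR : ∀ i, ‖z i‖ ≤ R := by
    intro i
    rw [hRdef, one_div, Real.le_rpow_inv_iff_of_pos (norm_nonneg _) hs0 hL]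
    exact Finset.single_le_sum (f := fun i => ‖z i‖ ^ Real.log M) (fun i _ => by positivity)
      (Finset.mem_univ i)
  have h := average_norm_signedSum_le z hR0 hR hM (by simpa using hn)
  rw [div_le_iff₀' (by exact_mod_cast Fintype.card_pos)] at h
  have h' := ENNReal.ofReal_le_ofReal h
  rw [ENNReal.ofReal_sum_of_nonneg fun _ _ => norm_nonneg _,
    ENNReal.ofReal_mul (by positivity), ENNReal.ofReal_natCast, mul_assoc (3 * √(Real.log M)),
    ENNReal.ofReal_mul (by positivity), ENNReal.ofReal_mul hR0, hRdef,
    ← ENNReal.ofReal_rpow_of_nonneg hs0 (by positivity),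
    ENNReal.ofReal_sum_of_nonneg fun _ _ => by positivity, Real.sqrt_eq_rpow ‖_‖,
    ← ENNReal.ofReal_rpow_of_nonneg (norm_nonneg _) (by norm_num)] at h'
  simp only [← ENNReal.ofReal_rpow_of_nonneg (norm_nonneg _) hL.le, ofReal_norm] at h'
  exact h'

/-- The operator `(1/M) ∑ zᵢ ⊗ zᵢ - id` as a function of the sample `z`. -/
noncomputable def covarianceError (z : Fin M → EuclideanSpace ℝ (Fin n)) :
    EuclideanSpace ℝ (Fin n) →L[ℝ] EuclideanSpace ℝ (Fin n) :=
  (1 / (M : ℝ)) • ∑ i, tens (z i) - ContinuousLinearMap.id ℝ (EuclideanSpace ℝ (Fin n))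

theorem measurable_enorm_covarianceError :
    Measurable fun z : Fin M → EuclideanSpace ℝ (Fin n) => ‖covarianceError z‖ₑ := by
  have h : Continuous fun z : Fin M → EuclideanSpace ℝ (Fin n) => covarianceError z := by
    unfold covarianceError
    have hs : Continuous fun z : Fin M → EuclideanSpace ℝ (Fin n) => ∑ i, tens (z i) :=
      continuous_finsetSum _ fun i _ => continuous_tens.comp (continuous_apply i)
    exact (hs.const_smul (1 / (M : ℝ))).sub continuous_const
  exact h.enorm.measurable

theorem lintegral_enorm_covarianceError_ne_top {P : Measure (EuclideanSpace ℝ (Fin n))}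
    [IsProbabilityMeasure P] (hint : Integrable tens P) :
    ∫⁻ z : Fin M → EuclideanSpace ℝ (Fin n), ‖covarianceError z‖ₑ
      ∂(Measure.pi fun _ => P) ≠ ⊤ := by
  have h : Integrable (fun z : Fin M → EuclideanSpace ℝ (Fin n) => covarianceError z)
      (Measure.pi fun _ => P) := by
    have hs : Integrable (fun z : Fin M → EuclideanSpace ℝ (Fin n) => ∑ i, tens (z i))
        (Measure.pi fun _ => P) :=
      integrable_finsetSum (f := fun i (z : Fin M → EuclideanSpace ℝ (Fin n)) => tens (z i)) _
        fun i _ => integrable_comp_coordinate P (H := tens) hint i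
    exact (hs.smul (1 / (M : ℝ))).sub (integrable_const _)
  exact h.hasFiniteIntegral.ne

/-- Symmetrization holds for each fixed sign pattern; summing over all of them brings in the
Rademacher average. -/
theorem lintegral_enorm_covarianceError_le_symmetrized
    {P : Measure (EuclideanSpace ℝ (Fin n))} [IsProbabilityMeasure P] (hM : 2 ≤ Real.log M)
    (hn : n ≤ M) (hint : Integrable tens P)
    (hid : ∫ x, tens x ∂P = ContinuousLinearMap.id ℝ (EuclideanSpace ℝ (Fin n))) :
    ∫⁻ z : Fin M → EuclideanSpace ℝ (Fin n), ‖covarianceError z‖ₑ ∂(Measure.pi fun _ => P) ≤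
      ENNReal.ofReal (6 * √(Real.log M) / M) * ∫⁻ z : Fin M → EuclideanSpace ℝ (Fin n),
        (∑ i, ‖z i‖ₑ ^ Real.log M) ^ (1 / Real.log M) * ‖∑ i, tens (z i)‖ₑ ^ (1 / 2 : ℝ)
        ∂(Measure.pi fun _ => P) := by
  set Q : Measure (Fin M → EuclideanSpace ℝ (Fin n)) := Measure.pi fun _ => P with hQ
  have hM0 : (M : ℝ) ≠ 0 := by rintro h; rw [h] at hM; norm_num at hM
  set N : ENNReal := (Fintype.card (Fin M → Bool) : ENNReal) with hN
  have hN0 : N ≠ 0 := by rw [hN]; exact_mod_cast Fintype.card_ne_zero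
  have hNt : N ≠ ⊤ := ENNReal.natCast_ne_top _
  have hsm : StronglyMeasurable (tens : EuclideanSpace ℝ (Fin n) → _) :=
    continuous_tens.stronglyMeasurable
  have hscale : ∀ z : Fin M → EuclideanSpace ℝ (Fin n), ‖covarianceError z‖ₑ =
      ENNReal.ofReal (1 / M) * ‖∑ i, (tens (z i) - ∫ x, tens x ∂P)‖ₑ := by
    intro z
    have h : covarianceError z = (1 / (M : ℝ)) • ∑ i, (tens (z i) - ∫ x, tens x ∂P) := by
      rw [covarianceError, hid, Finset.sum_sub_distrib, smul_sub, Finset.sum_const,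
        Finset.card_univ, Fintype.card_fin, ← Nat.cast_smul_eq_nsmul ℝ, smul_smul,
        one_div_mul_cancel hM0, one_smul]
    rw [h, enorm_smul, Real.enorm_eq_ofReal (by positivity)]
  have hε : ∀ ε : Fin M → Bool, ∫⁻ z, ‖covarianceError z‖ₑ ∂Q ≤
      ENNReal.ofReal (1 / M) * (2 * ∫⁻ z, ‖∑ i, boolSign (ε i) • tens (z i)‖ₑ ∂Q) := by
    intro ε
    simp_rw [hscale]
    rw [lintegral_const_mul' _ _ ENNReal.ofReal_ne_top]
    gcongr
    exact lintegral_enorm_sum_sub_integral_le P hsm hint ε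
  have hsum := Finset.sum_le_sum fun ε (_ : ε ∈ Finset.univ) => hε ε
  rw [Finset.sum_const, Finset.card_univ, nsmul_eq_mul, ← Finset.mul_sum, ← Finset.mul_sum,
    ← lintegral_finsetSum _ fun ε _ => measurable_enorm_sum_boolSign_smul hsm ε] at hsum
  refine (ENNReal.mul_le_mul_iff_right hN0 hNt).1 (hsum.trans ?_)
  calc _ ≤ ENNReal.ofReal (1 / M) * (2 * ∫⁻ z : Fin M → EuclideanSpace ℝ (Fin n),
        N * (ENNReal.ofReal (3 * √(Real.log M)) *
        ((∑ i, ‖z i‖ₑ ^ Real.log M) ^ (1 / Real.log M) * ‖∑ i, tens (z i)‖ₑ ^ (1 / 2 : ℝ)))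
        ∂Q) := by
        gcongr with z
        exact sum_enorm_signedSum_le hM hn z
    _ = _ := by
        rw [lintegral_const_mul' _ _ hNt, lintegral_const_mul' _ _ ENNReal.ofReal_ne_top]
        have h : ENNReal.ofReal (6 * √(Real.log M) / M) =
            ENNReal.ofReal (1 / M) * 2 * ENNReal.ofReal (3 * √(Real.log M)) := by
          rw [show (2 : ENNReal) = ENNReal.ofReal 2 by simp, ← ENNReal.ofReal_mul (by positivity),
            ← ENNReal.ofReal_mul (by positivity)]
          congr 1; ring
        rw [h]; ring

theorem natCast_rpow_one_div_log (hM : 2 ≤ Real.log M) :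
    (M : ENNReal) ^ (1 / Real.log M) ≤ ENNReal.ofReal 3 := by
  have hMpos : (0 : ℝ) < M := by
    rcases Nat.eq_zero_or_pos M with h | h
    · rw [h] at hM; norm_num at hM
    · exact_mod_cast h
  rw [← ENNReal.ofReal_natCast, ENNReal.ofReal_rpow_of_nonneg hMpos.le (by positivity),
    Real.rpow_def_of_pos hMpos, mul_one_div_cancel (by linarith)]
  exact ENNReal.ofReal_le_ofReal (by linarith [Real.exp_one_lt_d9])

/-- By Cauchy-Schwarz the two factors separate. The first is controlled by its moment of order
`log M ≥ 2`, which costs only `M ^ (1 / log M) = e`; the second by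
`‖∑ zᵢ ⊗ zᵢ‖ ≤ M (‖(1/M) ∑ zᵢ ⊗ zᵢ - id‖ + 1)`. -/
theorem lintegral_moment_mul_sqrt_le {P : Measure (EuclideanSpace ℝ (Fin n))}
    [IsProbabilityMeasure P] (hM : 2 ≤ Real.log M) :
    ∫⁻ z : Fin M → EuclideanSpace ℝ (Fin n),
        (∑ i, ‖z i‖ₑ ^ Real.log M) ^ (1 / Real.log M) * ‖∑ i, tens (z i)‖ₑ ^ (1 / 2 : ℝ)
        ∂(Measure.pi fun _ => P) ≤
      ENNReal.ofReal 3 * (∫⁻ x, ‖x‖ₑ ^ Real.log M ∂P) ^ (1 / Real.log M) *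
        (M * (∫⁻ z : Fin M → EuclideanSpace ℝ (Fin n), ‖covarianceError z‖ₑ
          ∂(Measure.pi fun _ => P) + 1)) ^ (1 / 2 : ℝ) := by
  set Q : Measure (Fin M → EuclideanSpace ℝ (Fin n)) := Measure.pi fun _ => P with hQ
  have hL : 0 < Real.log M := by linarith
  have hM0 : (M : ℝ) ≠ 0 := by rintro h; rw [h] at hM; norm_num at hM
  set G : (Fin M → EuclideanSpace ℝ (Fin n)) → ENNReal :=
    fun z => (∑ i, ‖z i‖ₑ ^ Real.log M) ^ (1 / Real.log M) with hG
  have hterm : ∀ i, Measurable fun z : Fin M → EuclideanSpace ℝ (Fin n) =>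
      ‖z i‖ₑ ^ Real.log M := fun i => by fun_prop
  have hGm : Measurable G := (Finset.measurable_fun_sum _ fun i _ => hterm i).pow_const _
  have hSm : Measurable fun z : Fin M → EuclideanSpace ℝ (Fin n) =>
      ‖∑ i, tens (z i)‖ₑ ^ (1 / 2 : ℝ) :=
    (continuous_finsetSum _ fun i _ =>
      continuous_tens.comp (continuous_apply i)).enorm.measurable.pow_const _
  have hholder := ENNReal.lintegral_mul_le_Lp_mul_Lq Q
    (Real.HolderConjugate.two_two) hGm.aemeasurable hSm.aemeasurable
  refine hholder.trans (mul_le_mul' ?_ ?_)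
  · have h1 : (∫⁻ z, G z ^ (2 : ℝ) ∂Q) ^ (1 / 2 : ℝ) ≤
        (∫⁻ z, G z ^ Real.log M ∂Q) ^ (1 / Real.log M) :=
      eLpNorm'_le_eLpNorm'_of_exponent_le (f := G) (by norm_num) hM Q hGm.aestronglyMeasurable
    refine h1.trans ?_
    have h2 : ∫⁻ z, G z ^ Real.log M ∂Q = M * ∫⁻ x, ‖x‖ₑ ^ Real.log M ∂P := by
      simp_rw [hG, ← ENNReal.rpow_mul, one_div_mul_cancel hL.ne', ENNReal.rpow_one]
      rw [lintegral_finsetSum _ fun i _ => hterm i]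
      have h3 : ∀ i, ∫⁻ z : Fin M → EuclideanSpace ℝ (Fin n), ‖z i‖ₑ ^ Real.log M ∂Q =
          ∫⁻ x, ‖x‖ₑ ^ Real.log M ∂P := fun i =>
        (measurePreserving_eval (fun _ : Fin M => P) i).lintegral_comp
          (f := fun x => ‖x‖ₑ ^ Real.log M) (by fun_prop)
      simp [h3]
    rw [h2, ENNReal.mul_rpow_of_nonneg _ _ (by positivity)]
    gcongr
    exact natCast_rpow_one_div_log hM
  · gcongr
    simp_rw [← ENNReal.rpow_mul]
    norm_num
    have hQ1 : ∫⁻ _, (1 : ENNReal) ∂Q = 1 := by simp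
    rw [← hQ1, ← lintegral_add_right _ measurable_const,
      ← lintegral_const_mul' _ _ (ENNReal.natCast_ne_top _)]
    refine lintegral_mono fun z => ?_
    have h : ∑ i, tens (z i) = (M : ℝ) • (covarianceError z +
        ContinuousLinearMap.id ℝ (EuclideanSpace ℝ (Fin n))) := by
      rw [covarianceError, sub_add_cancel, smul_smul, mul_one_div_cancel hM0, one_smul]
    rw [h, enorm_smul, Real.enorm_natCast]
    gcongr
    refine (enorm_add_le (covarianceError z) _).trans (add_le_add le_rfl ?_)
    rw [← ofReal_norm, ENNReal.ofReal_le_one]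
    exact ContinuousLinearMap.norm_id_le

/-- The self-bounding inequality `D ≤ (b/2) √(D + 1)` with `b < 1` forces `D ≤ b`. -/
theorem le_of_le_half_mul_sqrt_add_one {D b : ENNReal} (hD : D ≠ ⊤) (hb : b < 1)
    (h : D ≤ b / 2 * (D + 1) ^ (1 / 2 : ℝ)) : D ≤ b := by
  lift D to NNReal using hD
  lift b to NNReal using hb.ne_top
  have hb' : (b : ℝ) < 1 := by exact_mod_cast hb
  have h' : (D : ℝ) ≤ b / 2 * √(D + 1) := by
    have h1 := ENNReal.toReal_mono (by finiteness) h
    rw [ENNReal.toReal_mul, ENNReal.toReal_div, ← ENNReal.toReal_rpow,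
      ENNReal.toReal_add (by finiteness) (by finiteness)] at h1
    simpa [Real.sqrt_eq_rpow] using h1
  have hb0 := b.coe_nonneg
  have hs0 := Real.sqrt_nonneg ((D : ℝ) + 1)
  have hsq := Real.sq_sqrt (by positivity : (0 : ℝ) ≤ D + 1)
  have hs2 : √((D : ℝ) + 1) ≤ 2 := by nlinarith
  have : (D : ℝ) ≤ b := by nlinarith
  exact_mod_cast this

end Deviation

theorem theorem1 :
    ∃ C : ℝ, 0 < C ∧
      ∀ (n M : ℕ), 2 ≤ Real.log M →
      ∀ (Ω : Type*) [MeasurableSpace Ω] (μ : Measure Ω) [IsProbabilityMeasure μ]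
        (y : Ω → EuclideanSpace ℝ (Fin n)), AEMeasurable y μ → IsIsotropic μ y →
      ∀ (Ω' : Type*) [MeasurableSpace Ω'] (ν : Measure Ω') [IsProbabilityMeasure ν]
        (ys : Fin M → Ω' → EuclideanSpace ℝ (Fin n)),
        iIndepFun ys ν → (∀ i, IdentDistrib (ys i) y ν μ) →
        deviationBound C M μ y < 1 →
        expectedDeviation ν ys ≤ deviationBound C M μ y := by
  -- The constants collect as `36 = 2 * 2 * 3 * 3`: the self-bounding step, the symmetrization,
  -- the Rademacher inequality, and `M ^ (1 / log M) = e ≤ 3`.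
  refine ⟨36, by norm_num, ?_⟩
  intro n M hM Ω _ μ _ y hy hiso Ω' _ ν _ ys hindep hident hb
  set P : Measure (EuclideanSpace ℝ (Fin n)) := μ.map y with hP
  have : IsProbabilityMeasure P := Measure.isProbabilityMeasure_map hy
  have hMpos : (0 : ℝ) < M := by
    rcases Nat.eq_zero_or_pos M with h | h
    · rw [h] at hM; norm_num at hM
    · exact_mod_cast h
  have hint : Integrable tens P :=
    (integrable_map_measure continuous_tens.aestronglyMeasurable hy).2 hiso.1
  have hid : ∫ x, tens x ∂P = ContinuousLinearMap.id ℝ (EuclideanSpace ℝ (Fin n)) := by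
    rw [hP, integral_map hy continuous_tens.aestronglyMeasurable, hiso.2]
  have hbound : deviationBound 36 M P id = deviationBound 36 M μ y := by
    simp only [deviationBound, id]
    rw [hP, lintegral_map' (by fun_prop) hy]
  have hlaw : ν.map (fun ω i => ys i ω) = Measure.pi fun _ => P := by
    rw [(iIndepFun_iff_map_fun_eq_pi_map fun i => (hident i).aemeasurable_fst).1 hindep]
    exact congrArg _ (funext fun i => (hident i).map_eq)
  have hdev : expectedDeviation ν ys =
      ∫⁻ z, ‖covarianceError z‖ₑ ∂(Measure.pi fun _ : Fin M => P) := by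
    rw [← hlaw, lintegral_map' measurable_enorm_covarianceError.aemeasurable
      (aemeasurable_pi_lambda _ fun i => (hident i).aemeasurable_fst)]
    rfl
  rw [← hbound] at hb ⊢
  rw [hdev]
  have hn := dim_le_of_deviationBound_lt_one hM hint hid (by norm_num) hb
  refine le_of_le_half_mul_sqrt_add_one (lintegral_enorm_covarianceError_ne_top hint) hb ?_
  refine (lintegral_enorm_covarianceError_le_symmetrized hM hn hint hid).trans
    ((mul_le_mul_right (lintegral_moment_mul_sqrt_le hM) _).trans (le_of_eq ?_))
  have hsqrt : (M : ENNReal) ^ (1 / 2 : ℝ) = ENNReal.ofReal √M := by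
    rw [← ENNReal.ofReal_natCast, ENNReal.ofReal_rpow_of_nonneg (by positivity) (by norm_num),
      Real.sqrt_eq_rpow]
  have hconst : ENNReal.ofReal (36 * (√(Real.log M) / √M)) / 2 =
      ENNReal.ofReal (6 * √(Real.log M) / M) * ENNReal.ofReal 3 * ENNReal.ofReal √M := by
    rw [show (2 : ENNReal) = ENNReal.ofReal 2 by simp, ← ENNReal.ofReal_div_of_pos (by norm_num),
      ← ENNReal.ofReal_mul (by positivity), ← ENNReal.ofReal_mul (by positivity)]
    congr 1
    rw [show 6 * √(Real.log M) / M * 3 * √M = 18 * √(Real.log M) * (√M / M) by ring,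
      Real.sqrt_div_self]
    ring
  rw [ENNReal.mul_rpow_of_nonneg _ _ (by norm_num), hsqrt, deviationBound, ENNReal.mul_div_right_comm,
    hconst]
  simp only [id]
  ring
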